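/- Let $(V,Y,\mathbf 1,\omega)$ be a vertex operator algebra over $\mathbb C$: $V=\bigoplus_{n\in\mathbb Z}V_{(n)}$ with every $V_{(n)}$ finite dimensional and $V_{(n)}=0$ for $n$ sufficiently negative, with the usual lower truncation, vacuum and creation properties, Jacobi identity, Virasoro relations for the modes of $Y(\omega,x)=\sum_{n\in\mathbb Z}L(n)x^{-n-2}$, $L(0)|_{V_{(n)}}=n$, and $L(-1)$-derivative property. A weak $V$-module is a vector space $W$ with a linear map $Y_W:V\to(\mathrm{End}\,W)[[x,x^{-1}]]$, $Y_W(v,x)=\sum_{n\in\mathbb Z}v_nx^{-n-1}$, satisfying lower truncation, $Y_W(\mathbf 1,x)=\mathrm{Id}_W$, the Jacobi identity and $Y_W(L(-1)v,x)=\frac{d}{dx}Y_W(v,x)$. It is a generalized $V$-module if $W=\bigoplus_{h\in\mathbb C}W_{[h]}$, where $W_{[h]}$ is the generalized $L(0)$-eigenspace of eigenvalue $h$. A generalized $V$-module is grading-restricted if every $W_{[h]}$ is finite dimensional and, for every $h\in\mathbb C$, $W_{[h+n]}=0$ for all sufficiently negative integers $n$. It is $C_1$-cofinite if $\dim W/C_1(W)<\infty$,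 where $C_1(W)=\mathrm{span}\{v_{-1}w : v\in\bigoplus_{n\ge1}V_{(n)},\ w\in W\}$. For weak $V$-modules $W_1,W_2,W_3$, an intertwining operator of type $\binom{W_3}{W_1\,W_2}$ is a linear map $\mathcal Y:W_1\otimes W_2\to W_3[\log x]\{x\}$, $$w_1\otimes w_2\mapsto\mathcal Y(w_1,x)w_2=\sum_{h\in\mathbb C}\sum_{k\in\mathbb N}(w_1)_{h,k}w_2\,x^{-h-1}(\log x)^k$$ (for each $h$ only finitely many $k$ occur), such that: for all $h,w_1,w_2$ one has $(w_1)_{h+n,k}w_2=0$ for $n\in\mathbb N$ sufficiently large, independently of $k$; for all $v\in V$, $w_1\in W_1$, $$x_0^{-1}\delta\Big(\tfrac{x_1-x_2}{x_0}\Big)Y_{W_3}(v,x_1)\mathcal Y(w_1,x_2)-x_0^{-1}\delta\Big(\tfrac{x_2-x_1}{-x_0}\Big)\mathcal Y(w_1,x_2)Y_{W_2}(v,x_1)=x_2^{-1}\delta\Big(\tfrac{x_1-x_0}{x_2}\Big)\mathcal Y(Y_{W_1}(v,x_0)w_1,x_2);$$ and $\mathcal Y(L(-1)w_1,x)=\frac{d}{dx}\mathcal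 Y(w_1,x)$ for all $w_1\in W_1$. Its image is $\mathrm{im}\,\mathcal Y=\mathrm{span}\{(w_1)_{h,k}w_2 : w_1\in W_1,\ w_2\in W_2,\ h\in\mathbb C,\ k\in\mathbb N\}\subseteq W_3$. **Corollary.** Let $W_1,W_2$ be $C_1$-cofinite grading-restricted generalized $V$-modules, let $X$ be a generalized $V$-module, and let $\mathcal Y$ be an intertwining operator of type $\binom{X}{W_1\,W_2}$. Then $\mathrm{im}\,\mathcal Y$ is stable under all operators $v_n$ ($v\in V$, $n\in\mathbb Z$), and with the restricted vertex operator it is a $C_1$-cofinite grading-restricted generalized $V$-module. -/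

import Mathlib

namespace VOA

noncomputable section

universe u v v₁ v₂ v₃

/-- The Jacobi identity
`x₀⁻¹ δ((x₁ - x₂)/x₀) Y_W(a, x₁) Y_W(b, x₂) - x₀⁻¹ δ((x₂ - x₁)/(-x₀)) Y_W(b, x₂) Y_W(a, x₁)
  = x₂⁻¹ δ((x₁ - x₀)/x₂) Y_W(Y(a, x₀) b, x₂)`
applied to a vector `w`: equality of the coefficients of `x₀^(-l-1) x₁^(-m-1) x₂^(-n-1)` for all
integers `l, m, n`, where `Y_W(a, x) = ∑ₙ aₙ x^(-n-1)` and `YW a n` is the mode `aₙ`.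
All sums are finite as soon as `Y` and `YW` are lower truncated. -/
def Jacobi {V : Type u} {W : Type v} [AddCommGroup V] [Module ℂ V] [AddCommGroup W] [Module ℂ W]
    (Y : V →ₗ[ℂ] ℤ → Module.End ℂ V) (YW : V →ₗ[ℂ] ℤ → Module.End ℂ W) : Prop :=
  ∀ (a b : V) (w : W) (l m n : ℤ),
    (∑ᶠ i : ℕ, ((-1 : ℂ) ^ i * (Ring.choose l i : ℤ)) • YW a (m + l - i) (YW b (n + i) w))
      - (∑ᶠ i : ℕ, ((-1 : ℂ) ^ (l + i) * (Ring.choose l i : ℤ)) •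
          YW b (n + l - i) (YW a (m + i) w))
    = ∑ᶠ i : ℕ, ((Ring.choose m i : ℤ) : ℂ) • YW (Y a (l + i) b) (m + n - i) w

/-- A vertex operator algebra structure `(Y, 𝟏, ω)` on a complex vector space `V` with grading
`V = ⨁_{n ∈ ℤ} V_(n)`. The vertex operator is recorded through its modes:
`Y(a, x) = ∑ₙ aₙ x^(-n-1)` with `aₙ = Y a n`, so `L(n) = ω_{n+1} = Y ω (n + 1)`. -/
structure VertexOperatorAlgebra (V : Type u) [AddCommGroup V] [Module ℂ V] where
  /-- The modes of the vertex operator `V → (End V)[[x, x⁻¹]]`. -/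
  Y : V →ₗ[ℂ] ℤ → Module.End ℂ V
  /-- The vacuum vector `𝟏`. -/
  vac : V
  /-- The conformal vector `ω`. -/
  conf : V
  /-- The homogeneous subspace `V_(n)` of conformal weight `n`. -/
  wt : ℤ → Submodule ℂ V
  /-- The central charge. -/
  centralCharge : ℂ
  isInternal_wt : DirectSum.IsInternal wt
  finiteDimensional_wt : ∀ n, FiniteDimensional ℂ (wt n)
  wt_eq_bot : ∃ N : ℤ, ∀ n ≤ N, wt n = ⊥
  lower_truncation : ∀ a b : V, ∃ N : ℕ, ∀ n : ℕ, N ≤ n → Y a n b = 0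
  /-- The vacuum property `Y(𝟏, x) = Id`. -/
  vacuum : ∀ n : ℤ, Y vac n = if n = -1 then LinearMap.id else 0
  /-- The creation property: `Y(a, x)𝟏` is a power series with constant term `a`. -/
  creation : ∀ a : V, (∀ n : ℕ, Y a n vac = 0) ∧ Y a (-1) vac = a
  jacobi : Jacobi Y Y
  vac_mem : vac ∈ wt 0
  conf_mem : conf ∈ wt 2
  /-- `[L(m), L(n)] = (m - n) L(m + n) + (m³ - m)/12 δ_{m+n,0} c`. -/
  virasoro : ∀ m n : ℤ,
    Y conf (m + 1) ∘ₗ Y conf (n + 1) - Y conf (n + 1) ∘ₗ Y conf (m + 1)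
      = ((m : ℂ) - n) • Y conf (m + n + 1)
        + (if m + n = 0 then (((m : ℂ) ^ 3 - m) / 12) * centralCharge else 0) •
          (LinearMap.id : V →ₗ[ℂ] V)
  /-- `L(0)` acts on `V_(n)` as multiplication by `n`. -/
  L_zero : ∀ (n : ℤ), ∀ a ∈ wt n, Y conf 1 a = (n : ℂ) • a
  /-- `Y(L(-1)a, x) = d/dx Y(a, x)`. -/
  L_neg_one_derivative : ∀ (a : V) (n : ℤ), Y (Y conf 0 a) n = (-(n : ℂ)) • Y a (n - 1)

/-- A weak module structure on `W` over the vertex operator algebra `A`, given by the modes of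
the vertex operator `Y_W : V → (End W)[[x, x⁻¹]]`, `Y_W(a, x) = ∑ₙ aₙ x^(-n-1)`,
`aₙ = Y a n`. -/
structure WeakModule {V : Type u} [AddCommGroup V] [Module ℂ V] (A : VertexOperatorAlgebra V)
    (W : Type v) [AddCommGroup W] [Module ℂ W] where
  /-- The modes of the vertex operator. -/
  Y : V →ₗ[ℂ] ℤ → Module.End ℂ W
  lower_truncation : ∀ (a : V) (w : W), ∃ N : ℕ, ∀ n : ℕ, N ≤ n → Y a n w = 0
  vacuum : ∀ n : ℤ, Y A.vac n = if n = -1 then LinearMap.id else 0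
  jacobi : Jacobi A.Y Y
  /-- `Y_W(L(-1)a, x) = d/dx Y_W(a, x)`. -/
  L_neg_one_derivative : ∀ (a : V) (n : ℤ), Y (A.Y A.conf 0 a) n = (-(n : ℂ)) • Y a (n - 1)

namespace WeakModule

variable {V : Type u} [AddCommGroup V] [Module ℂ V] {A : VertexOperatorAlgebra V}
  {W : Type v} [AddCommGroup W] [Module ℂ W]

/-- The operator `L(n) = ω_{n+1}` on a weak module. -/
def L (M : WeakModule A W) (n : ℤ) : Module.End ℂ W := M.Y A.conf (n + 1)

/-- `W_[h]`, the vectors annihilated by some power of `L(0) - h`. -/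
def weightSpace (M : WeakModule A W) (h : ℂ) : Submodule ℂ W :=
  (M.L 0).maxGenEigenspace h

open Classical in
/-- A weak module is a generalized module if `W = ⨁_{h ∈ ℂ} W_[h]`. -/
def IsGeneralized (M : WeakModule A W) : Prop :=
  DirectSum.IsInternal M.weightSpace

/-- The grading-restriction conditions: every `W_[h]` is finite dimensional, and for every `h`,
`W_[h+n] = 0` for all sufficiently negative integers `n`. -/
def IsGradingRestricted (M : WeakModule A W) : Prop :=
  (∀ h : ℂ, FiniteDimensional ℂ (M.weightSpace h)) ∧
    ∀ h : ℂ, ∃ N : ℤ, ∀ n : ℤ, n ≤ N → M.weightSpace (h + n) = ⊥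

/-- `C₁(W)`, the span of all `a_{-1} w` with `a ∈ ⨁_{n ≥ 1} V_(n)` and `w ∈ W`. -/
def C₁ (M : WeakModule A W) : Submodule ℂ W :=
  Submodule.span ℂ
    {x | ∃ a ∈ (⨆ n : {n : ℤ // 1 ≤ n}, A.wt n : Submodule ℂ V), ∃ w : W, x = M.Y a (-1) w}

/-- `W` is `C₁`-cofinite if `W / C₁(W)` is finite dimensional. -/
def IsC₁Cofinite (M : WeakModule A W) : Prop := FiniteDimensional ℂ (W ⧸ M.C₁)

/-- `W` is a `C₁`-cofinite grading-restricted generalized module. -/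
structure IsC₁Module (M : WeakModule A W) : Prop where
  isGeneralized : M.IsGeneralized
  isGradingRestricted : M.IsGradingRestricted
  isC₁Cofinite : M.IsC₁Cofinite

/-- A subspace is invariant if it is stable under all modes `aₙ`. -/
def IsInvariant (M : WeakModule A W) (S : Submodule ℂ W) : Prop :=
  ∀ (a : V) (n : ℤ), ∀ w ∈ S, M.Y a n w ∈ S

/-- An invariant subspace with the restricted vertex operator is a weak module. -/
def restrict (M : WeakModule A W) (S : Submodule ℂ W) (hS : M.IsInvariant S) :
    WeakModule A S where
  Y :=
    { toFun := fun a n => (M.Y a n).restrict (hS a n)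
      map_add' := fun a b => by ext n w; simp
      map_smul' := fun c a => by ext n w; simp }
  lower_truncation a w := by
    obtain ⟨N, hN⟩ := M.lower_truncation a w
    exact ⟨N, fun n hn => Subtype.ext (hN n hn)⟩
  vacuum n := by
    ext w
    have h := LinearMap.congr_fun (M.vacuum n) (w : W)
    by_cases hn : n = -1
    · simpa [hn] using h
    · simpa [hn] using h
  jacobi a b w l m n := by
    apply Subtype.ext
    have h := M.jacobi a b w l m n
    have key : ∀ f : ℕ → S, ((∑ᶠ i, f i : S) : W) = ∑ᶠ i, (f i : W) := fun f =>
      AddMonoidHom.map_finsum_of_injective S.subtype.toAddMonoidHom Subtype.val_injective f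
    rw [AddSubgroupClass.coe_sub, key, key, key]
    exact h
  L_neg_one_derivative a n := by
    ext w
    exact LinearMap.congr_fun (M.L_neg_one_derivative a n) (w : W)

end WeakModule

/-- A (logarithmic) intertwining operator of type `(W₃ over W₁ W₂)`: a bilinear map
`(w₁, w₂) ↦ 𝒴(w₁, x)w₂ = ∑_{h ∈ ℂ} ∑_{k ∈ ℕ} (w₁)_{h,k} w₂ x^(-h-1) (log x)^k` into
`W₃[log x]{x}` (arbitrary complex powers of `x`, coefficients polynomial in `log x`), where
`(w₁)_{h,k} w₂ = coeff w₁ w₂ h k`. -/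
structure IntertwiningOperator {V : Type u} [AddCommGroup V] [Module ℂ V]
    {A : VertexOperatorAlgebra V}
    {W₁ : Type v₁} [AddCommGroup W₁] [Module ℂ W₁] (M₁ : WeakModule A W₁)
    {W₂ : Type v₂} [AddCommGroup W₂] [Module ℂ W₂] (M₂ : WeakModule A W₂)
    {W₃ : Type v₃} [AddCommGroup W₃] [Module ℂ W₃] (M₃ : WeakModule A W₃) where
  /-- The coefficients `(w₁)_{h,k} w₂`. -/
  coeff : W₁ →ₗ[ℂ] W₂ →ₗ[ℂ] ℂ → (ℕ →₀ W₃)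
  /-- `(w₁)_{h+n,k} w₂ = 0` for all sufficiently large `n ∈ ℕ`, independently of `k`. -/
  lower_truncation : ∀ (h : ℂ) (w₁ : W₁) (w₂ : W₂),
    ∃ N : ℕ, ∀ n : ℕ, N ≤ n → ∀ k : ℕ, coeff w₁ w₂ (h + n) k = 0
  /-- The Jacobi identity
  `x₀⁻¹ δ((x₁ - x₂)/x₀) Y_{W₃}(a, x₁) 𝒴(w₁, x₂) - x₀⁻¹ δ((x₂ - x₁)/(-x₀)) 𝒴(w₁, x₂) Y_{W₂}(a, x₁)
    = x₂⁻¹ δ((x₁ - x₀)/x₂) 𝒴(Y_{W₁}(a, x₀) w₁, x₂)`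
  applied to `w₂`: equality of the coefficients of
  `x₀^(-l-1) x₁^(-m-1) x₂^(-h-1) (log x₂)^k`. -/
  jacobi : ∀ (a : V) (w₁ : W₁) (w₂ : W₂) (l m : ℤ) (h : ℂ) (k : ℕ),
    (∑ᶠ i : ℕ, ((-1 : ℂ) ^ i * (Ring.choose l i : ℤ)) •
        M₃.Y a (m + l - i) (coeff w₁ w₂ (h + i) k))
      - (∑ᶠ i : ℕ, ((-1 : ℂ) ^ (l + i) * (Ring.choose l i : ℤ)) •
          coeff w₁ (M₂.Y a (m + i) w₂) (h + l - i) k)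
    = ∑ᶠ i : ℕ, ((Ring.choose m i : ℤ) : ℂ) • coeff (M₁.Y a (l + i) w₁) w₂ (m + h - i) k
  /-- `𝒴(L(-1)w₁, x) = d/dx 𝒴(w₁, x)`: equality of the coefficients of
  `x^(-h-1) (log x)^k`. -/
  L_neg_one_derivative : ∀ (w₁ : W₁) (w₂ : W₂) (h : ℂ) (k : ℕ),
    coeff (M₁.L (-1) w₁) w₂ h k
      = (-h) • coeff w₁ w₂ (h - 1) k + ((k : ℂ) + 1) • coeff w₁ w₂ (h - 1) (k + 1)

/-- The image of an intertwining operator: the span of all `(w₁)_{h,k} w₂`. -/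
def IntertwiningOperator.im {V : Type u} [AddCommGroup V] [Module ℂ V]
    {A : VertexOperatorAlgebra V}
    {W₁ : Type v₁} [AddCommGroup W₁] [Module ℂ W₁] {M₁ : WeakModule A W₁}
    {W₂ : Type v₂} [AddCommGroup W₂] [Module ℂ W₂] {M₂ : WeakModule A W₂}
    {W₃ : Type v₃} [AddCommGroup W₃] [Module ℂ W₃] {M₃ : WeakModule A W₃}
    (𝒴 : IntertwiningOperator M₁ M₂ M₃) : Submodule ℂ W₃ :=
  Submodule.span ℂ {x | ∃ (w₁ : W₁) (w₂ : W₂) (h : ℂ) (k : ℕ), x = 𝒴.coeff w₁ w₂ h k}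

end

end VOA

namespace VOA

/-! For `v` of positive weight, the Jacobi identity rewrites `𝒴(v_{-1}u, x)w` and `𝒴(u, x)v_{-1}w`
through modes `v_{-1-i}` applied to coefficients of `𝒴(u, x)w`, plus terms `𝒴(u, x)v_i w` or `𝒴(v_i
u, x)w` with `i ≥ 0`. Every pair of arguments so produced has smaller total weight, so induction
(`homogeneous_pair_induction`) reduces to weights whose weight spaces are not contained in `C₁`. By
cofiniteness there are finitely many, each with a finite-dimensional weight space.

Lower bound (`im_lower_bounded`): lower truncation is uniform on these finitely many base spaces,
and the modes `v_{-1-i}` only raise weights.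

Cofiniteness (`fg_map_mkQ_im`): modulo `C₁(im 𝒴)` the terms `v_{-1-i}(...)` vanish. For `u`, `w` of
weights `a`, `b`, the normalized series `x^(a+b) 𝒴(u, x)w` then satisfy relations with scalar
coefficients, without powers of `x`, so they span a finite-dimensional space. The `L(-1)`-derivative
property makes it stable under `x d/dx`, so only finitely many exponents occur and the coefficients
span a finite-dimensional space (`fg_span_coeff`).

Finite-dimensional weight spaces then follow from cofiniteness and the lower bound
(`weightSpace_finiteDimensional`). -/

/-! ### Independent families and finite sums with binomial coefficients. -/

theorem mem_of_mem_iSup_of_iSupIndep {ι R M : Type*} [Ring R] [AddCommGroup M] [Module R M]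
    {p q : ι → Submodule R M} (hq : iSupIndep q) (hpq : ∀ i, p i ≤ q i) {i : ι} {x : M}
    (hx : x ∈ ⨆ j, p j) (hxi : x ∈ q i) : x ∈ p i := by
  have hle : (⨆ j, p j) ≤ p i ⊔ ⨆ (j) (_ : j ≠ i), q j := by
    refine iSup_le fun j => ?_
    by_cases hj : j = i
    · subst hj; exact le_sup_left
    · exact (hpq j).trans ((le_iSup₂ (f := fun j (_ : j ≠ i) => q j) j hj).trans le_sup_right)
  obtain ⟨y, hy, z, hz, rfl⟩ := Submodule.mem_sup.1 (hle hx)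
  have hz' : z ∈ q i := by simpa using sub_mem hxi (hpq i hy)
  have : z = 0 := by
    have h := (Submodule.disjoint_def.1 (hq i)) z hz' hz
    exact h
  simpa [this] using hy

theorem finsum_mem_submodule {α R M : Type*} [Semiring R] [AddCommMonoid M] [Module R M]
    (S : Submodule R M) {f : α → M} (h : ∀ i, f i ∈ S) : (∑ᶠ i, f i) ∈ S :=
  finsum_induction (· ∈ S) S.zero_mem (fun _ _ => S.add_mem) h

theorem finsum_choose_zero {M : Type*} [AddCommGroup M] [Module ℂ M] (f : ℕ → M) (s : ℕ → ℂ) :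
    (∑ᶠ i : ℕ, (s i * (Ring.choose (0 : ℤ) i : ℤ)) • f i) = s 0 • f 0 := by
  rw [finsum_eq_single _ 0]
  · simp
  · intro i hi
    rw [Ring.choose_zero_pos ℤ (Nat.pos_of_ne_zero hi)]
    simp

theorem finsum_choose_one {M : Type*} [AddCommGroup M] [Module ℂ M] (f : ℕ → M) :
    (∑ᶠ i : ℕ, ((Ring.choose (1 : ℤ) i : ℤ) : ℂ) • f i) = f 0 + f 1 := by
  rw [finsum_eq_sum_of_support_subset (s := Finset.range 2)]
  · simp [Finset.sum_range_succ]
  · intro i hi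
    simp only [Finset.coe_range, Set.mem_Iio]
    by_contra hc
    refine hi ?_
    have : Ring.choose (1 : ℤ) i = 0 := by
      have h := Ring.choose_natCast (R := ℤ) 1 i
      rw [Nat.choose_eq_zero_of_lt (by omega)] at h
      simpa using h
    simp [this]

/-! ### Weights and `C₁` in a single module. -/

namespace VertexOperatorAlgebra

variable {V : Type*} [AddCommGroup V] [Module ℂ V] (A : VertexOperatorAlgebra V)

/-- The vertex operator algebra as a module over itself. -/
def adjoint : WeakModule A V where
  Y := A.Y
  lower_truncation := A.lower_truncation
  vacuum := A.vacuum
  jacobi := A.jacobi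
  L_neg_one_derivative := A.L_neg_one_derivative

/-- The subspace `⨁_{n ≥ 1} V_(n)`. -/
def positivePart : Submodule ℂ V := ⨆ n : {n : ℤ // 1 ≤ n}, A.wt n

theorem wt_le_positivePart {n : ℤ} (hn : 1 ≤ n) : A.wt n ≤ A.positivePart :=
  le_iSup (fun n : {n : ℤ // 1 ≤ n} => A.wt n) ⟨n, hn⟩

theorem mem_wt_of_L_zero {n : ℤ} {a : V} (h : A.Y A.conf 1 a = (n : ℂ) • a) : a ∈ A.wt n := by
  have hind : iSupIndep fun n : ℤ => Module.End.eigenspace (A.Y A.conf 1) (n : ℂ) :=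
    (Module.End.eigenspaces_iSupIndep (A.Y A.conf 1)).comp Int.cast_injective
  refine mem_of_mem_iSup_of_iSupIndep hind
    (fun m b hb => Module.End.mem_eigenspace_iff.2 (A.L_zero m b hb)) ?_
    (Module.End.mem_eigenspace_iff.2 h)
  rw [A.isInternal_wt.submodule_iSup_eq_top]
  trivial

end VertexOperatorAlgebra

namespace WeakModule

variable {V : Type*} [AddCommGroup V] [Module ℂ V] {A : VertexOperatorAlgebra V}
  {W : Type*} [AddCommGroup W] [Module ℂ W] (M : WeakModule A W)

/-- The Jacobi identity at `l = 0`, `m = 1` gives `[L(0), b_n] = (L(-1)b)_{n+1} + (L(0)b)_n`, and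
the first term is `-(n+1) b_n`. -/
theorem L_zero_mode {p : ℤ} {b : V} (hb : b ∈ A.wt p) (n : ℤ) (w : W) :
    M.L 0 (M.Y b n w) = M.Y b n (M.L 0 w) + ((p : ℂ) - n - 1) • M.Y b n w := by
  have h := M.jacobi A.conf b w 0 1 n
  have e1 := finsum_choose_zero (fun i => M.Y A.conf (1 + 0 - (i : ℤ)) (M.Y b (n + i) w))
    (fun i => (-1) ^ i)
  have e2 := finsum_choose_zero (fun i => M.Y b (n + 0 - (i : ℤ)) (M.Y A.conf (1 + i) w))
    (fun i => (-1) ^ (0 + (i : ℤ)))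
  rw [finsum_choose_one, e1, e2] at h
  have h0 := A.L_zero p b hb
  have h1 := LinearMap.congr_fun (M.L_neg_one_derivative b (n + 1)) w
  simp only [pow_zero, Nat.cast_zero, add_zero, zpow_zero, one_smul, sub_zero,
    Nat.cast_one, zero_add] at h
  have e3 : (1 : ℤ) + n - 1 = n := by ring
  have e4 : (1 : ℤ) + n = n + 1 := by ring
  rw [h0, e3, e4, h1, map_smul] at h
  simp only [L, zero_add]
  rw [sub_eq_iff_eq_add] at h
  rw [h]
  simp only [Pi.smul_apply, LinearMap.smul_apply, Int.cast_add, Int.cast_one, add_sub_cancel_right]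
  module

theorem L_zero_sub_mode {p : ℤ} {b : V} (hb : b ∈ A.wt p) (n : ℤ) (a : ℂ) (w : W) :
    (M.L 0 - (a + p - n - 1) • (1 : Module.End ℂ W)) (M.Y b n w)
      = M.Y b n ((M.L 0 - a • (1 : Module.End ℂ W)) w) := by
  simp only [LinearMap.sub_apply, LinearMap.smul_apply, Module.End.one_apply, map_sub, map_smul,
    M.L_zero_mode hb]
  module

theorem mode_mem_weightSpace {p : ℤ} {b : V} (hb : b ∈ A.wt p) (n : ℤ) {a : ℂ} {w : W}
    (hw : w ∈ M.weightSpace a) : M.Y b n w ∈ M.weightSpace (a + p - n - 1) := by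
  obtain ⟨k, hk⟩ := (Module.End.mem_maxGenEigenspace _ _ _).1 hw
  refine (Module.End.mem_maxGenEigenspace _ _ _).2 ⟨k, ?_⟩
  have key : ∀ (k : ℕ) (w : W),
      ((M.L 0 - (a + p - n - 1) • (1 : Module.End ℂ W)) ^ k) (M.Y b n w)
        = M.Y b n (((M.L 0 - a • (1 : Module.End ℂ W)) ^ k) w) := by
    intro k
    induction k with
    | zero => simp
    | succ k ih =>
      intro w
      rw [pow_succ, pow_succ, Module.End.mul_apply, Module.End.mul_apply, M.L_zero_sub_mode hb, ih]
  rw [key, hk, map_zero]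

theorem mem_weightSpace_of_sub {c : ℂ} {x : W} (h : M.L 0 x - c • x ∈ M.weightSpace c) :
    x ∈ M.weightSpace c := by
  obtain ⟨k, hk⟩ := (Module.End.mem_maxGenEigenspace _ _ _).1 h
  refine (Module.End.mem_maxGenEigenspace _ _ _).2 ⟨k + 1, ?_⟩
  rw [pow_succ, Module.End.mul_apply]
  simpa using hk

theorem iSupIndep_weightSpace : iSupIndep M.weightSpace :=
  Module.End.independent_maxGenEigenspace _

theorem isGeneralized_iff : M.IsGeneralized ↔ ⨆ h, M.weightSpace h = ⊤ := by
  classical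
  rw [IsGeneralized, DirectSum.isInternal_submodule_iff_iSupIndep_and_iSup_eq_top]
  exact ⟨fun h => h.2, fun h => ⟨M.iSupIndep_weightSpace, h⟩⟩

theorem conf_zero_mem_wt {n : ℤ} {v : V} (hv : v ∈ A.wt n) : A.Y A.conf 0 v ∈ A.wt (n + 1) := by
  refine A.mem_wt_of_L_zero ?_
  have h := A.adjoint.L_zero_mode A.conf_mem 0 v
  simp only [L, VertexOperatorAlgebra.adjoint, zero_add] at h
  rw [h, A.L_zero n v hv, map_smul]
  push_cast
  module

/-- Since `(L(-1)v)_{-1-i} = (i+1) v_{-2-i}` and `L(-1)v` has weight `n + 1`, induction on `i`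
starts from the definition of `C₁`. -/
theorem mode_neg_mem_C₁ {n : ℤ} (hn : 1 ≤ n) {v : V} (hv : v ∈ A.wt n) (i : ℕ) (w : W) :
    M.Y v (-1 - i) w ∈ M.C₁ := by
  induction i generalizing n v with
  | zero => exact Submodule.subset_span ⟨v, A.wt_le_positivePart hn hv, w, by simp⟩
  | succ i ih =>
    have h1 := LinearMap.congr_fun (M.L_neg_one_derivative v (-1 - i)) w
    have h2 := ih (n := n + 1) (by omega) (conf_zero_mem_wt hv)
    rw [h1] at h2
    have e : (-1 - (i : ℤ)) - 1 = -1 - ((i + 1 : ℕ) : ℤ) := by push_cast; ring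
    rw [e] at h2
    refine (Submodule.smul_mem_iff _ ?_).1 h2
    have : ((i : ℂ) + 1) ≠ 0 := Nat.cast_add_one_ne_zero i
    push_cast
    intro h
    apply this
    linear_combination h

/-- The part of `C₁(W)` in the weight space `W_[a]`. -/
def homogeneousC₁ (a : ℂ) : Submodule ℂ W :=
  Submodule.span ℂ {x | ∃ n : ℤ, 1 ≤ n ∧ ∃ v ∈ A.wt n, ∃ w ∈ M.weightSpace (a - n),
    x = M.Y v (-1) w}

theorem homogeneousC₁_le_weightSpace (a : ℂ) : M.homogeneousC₁ a ≤ M.weightSpace a := by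
  refine Submodule.span_le.2 ?_
  rintro x ⟨n, -, v, hv, w, hw, rfl⟩
  have h := M.mode_mem_weightSpace hv (-1) hw
  have e : a - n + n - ((-1 : ℤ) : ℂ) - 1 = a := by push_cast; ring
  rwa [e] at h

variable {M}

theorem C₁_le_iSup (hM : M.IsGeneralized) : M.C₁ ≤ ⨆ a, M.homogeneousC₁ a := by
  refine Submodule.span_le.2 ?_
  rintro x ⟨v, hv, w, rfl⟩
  have hw : w ∈ ⨆ h, M.weightSpace h := by rw [M.isGeneralized_iff.1 hM]; trivial
  show M.Y v (-1) w ∈ _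
  induction hv using Submodule.iSup_induction' with
  | zero => simp
  | add v v' _ _ h h' => simpa using add_mem h h'
  | mem n v hv =>
    induction hw using Submodule.iSup_induction' with
    | zero => simp
    | add v v' _ _ h h' => simpa using add_mem h h'
    | mem a w hw =>
      refine Submodule.mem_iSup_of_mem (a + (n : ℤ)) (Submodule.subset_span
        ⟨n, n.2, v, hv, w, by simpa using hw, rfl⟩)

theorem mem_homogeneousC₁ (hM : M.IsGeneralized) {a : ℂ} {w : W} (hw : w ∈ M.weightSpace a)
    (hC : w ∈ M.C₁) : w ∈ M.homogeneousC₁ a :=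
  mem_of_mem_iSup_of_iSupIndep M.iSupIndep_weightSpace M.homogeneousC₁_le_weightSpace
    (C₁_le_iSup hM hC) hw

theorem L_zero_mem_C₁ (M : WeakModule A W) {w : W} (hw : w ∈ M.C₁) : M.L 0 w ∈ M.C₁ := by
  induction hw using Submodule.span_induction with
  | zero => simp
  | add x y _ _ hx hy => simpa using add_mem hx hy
  | smul c x _ hx => simpa using M.C₁.smul_mem c hx
  | mem x hx =>
    obtain ⟨v, hv, w, rfl⟩ := hx
    induction hv using Submodule.iSup_induction' with
    | zero => simp
    | add v v' _ _ h h' => simpa using add_mem h h'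
    | mem n v hv =>
      rw [M.L_zero_mode hv]
      have key : ∀ w, M.Y v (-1) w ∈ M.C₁ := fun w =>
        Submodule.subset_span ⟨v, A.wt_le_positivePart n.2 hv, w, rfl⟩
      exact add_mem (key _) (Submodule.smul_mem _ _ (key _))

/-- `L(0)` preserves `C₁(W)` and so acts on the finite-dimensional quotient. A weight space outside
`C₁` gives a nonzero generalized eigenspace there. -/
theorem finite_weightSpace_not_le_C₁ (hC : M.IsC₁Cofinite) :
    {a : ℂ | ¬ M.weightSpace a ≤ M.C₁}.Finite := by
  have : FiniteDimensional ℂ (W ⧸ M.C₁) := hC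
  let f : Module.End ℂ (W ⧸ M.C₁) := M.C₁.mapQ M.C₁ (M.L 0) fun w hw => M.L_zero_mem_C₁ hw
  refine (WellFoundedGT.finite_ne_bot_of_iSupIndep
    (Module.End.independent_maxGenEigenspace f)).subset ?_
  intro a ha hbot
  refine ha fun w hw => ?_
  obtain ⟨k, hk⟩ := (Module.End.mem_maxGenEigenspace _ _ _).1 hw
  have key : ∀ (k : ℕ) (w : W), ((f - a • (1 : Module.End ℂ (W ⧸ M.C₁))) ^ k) (M.C₁.mkQ w)
      = M.C₁.mkQ (((M.L 0 - a • (1 : Module.End ℂ W)) ^ k) w) := by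
    intro k
    induction k with
    | zero => simp
    | succ k ih =>
      intro w
      rw [pow_succ, pow_succ, Module.End.mul_apply, Module.End.mul_apply, ← ih]
      rfl
  have hmem : M.C₁.mkQ w ∈ f.maxGenEigenspace a :=
    (Module.End.mem_maxGenEigenspace _ _ _).2 ⟨k, by rw [key, hk, map_zero]⟩
  rw [hbot, Submodule.mem_bot] at hmem
  simpa using hmem

/-- Upward induction on the weight: modulo `C₁` the weight space is finite dimensional, and its part
in `C₁` comes from `V_(m) ⊗ W_[h+n-m]` with `m ≥ 1`. The lower bound leaves finitely many `m`. -/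
theorem weightSpace_finiteDimensional (hM : M.IsGeneralized) (hC : M.IsC₁Cofinite)
    (hb : ∀ h : ℂ, ∃ N : ℤ, ∀ n : ℤ, n ≤ N → M.weightSpace (h + n) = ⊥) (h : ℂ) :
    FiniteDimensional ℂ (M.weightSpace h) := by
  have : FiniteDimensional ℂ (W ⧸ M.C₁) := hC
  obtain ⟨N, hN⟩ := hb h
  have key : ∀ (s : ℕ) (n : ℤ), n < N + s → (M.weightSpace (h + n)).FG := by
    intro s
    induction s with
    | zero =>
      intro n hn
      rw [hN n (by omega)]
      exact Submodule.fg_bot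
    | succ s ih =>
      intro n hn
      refine Submodule.fg_of_fg_map_of_fg_inf_ker M.C₁.mkQ (IsNoetherian.noetherian _) ?_
      have hfin : (⨆ m ∈ Finset.Icc (1 : ℤ) (n - N), Submodule.map₂
          (LinearMap.mk₂ ℂ (fun v w => M.Y v (-1) w) (by simp) (by simp) (by simp) (by simp))
          (A.wt m) (M.weightSpace (h + (n - m : ℤ)))).FG := by
        refine Submodule.fg_biSup _ _ fun m hm => Submodule.FG.map₂ _ ?_ (ih _ ?_)
        · exact (Submodule.fg_iff_finiteDimensional _).2 (A.finiteDimensional_wt m)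
        · have := (Finset.mem_Icc.1 hm).1
          push_cast at hn
          omega
      have hle : M.weightSpace (h + n) ⊓ LinearMap.ker M.C₁.mkQ ≤
          ⨆ m ∈ Finset.Icc (1 : ℤ) (n - N), Submodule.map₂
          (LinearMap.mk₂ ℂ (fun v w => M.Y v (-1) w) (by simp) (by simp) (by simp) (by simp))
          (A.wt m) (M.weightSpace (h + (n - m : ℤ))) := by
        rintro w ⟨hw, hwC⟩
        rw [Submodule.ker_mkQ] at hwC
        have hw' := mem_homogeneousC₁ hM hw hwC
        refine Submodule.span_le.2 ?_ hw'
        rintro x ⟨m, hm, v, hv, w, hw, rfl⟩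
        have e : h + n - m = h + ((n - m : ℤ) : ℂ) := by push_cast; ring
        rw [e] at hw
        by_cases hmN : m ≤ n - N
        · refine Submodule.mem_iSup_of_mem m (Submodule.mem_iSup_of_mem
            (Finset.mem_Icc.2 ⟨hm, hmN⟩) ?_)
          exact Submodule.apply_mem_map₂ (LinearMap.mk₂ ℂ (fun v w => M.Y v (-1) w) _ _ _ _) hv hw
        · by_cases hmN' : n - m ≤ N
          · rw [hN _ hmN', Submodule.mem_bot] at hw
            simp [hw]
          · omega
      have : FiniteDimensional ℂ _ := (Submodule.fg_iff_finiteDimensional _).1 hfin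
      exact (Submodule.fg_iff_finiteDimensional _).2 (Submodule.finiteDimensional_of_le hle)
  have := key (1 - N).toNat 0 (by omega)
  rw [Int.cast_zero, add_zero] at this
  exact (Submodule.fg_iff_finiteDimensional _).1 this

end WeakModule

/-! ### Commutator and iterate formulas; weights of coefficients. -/

namespace IntertwiningOperator

variable {V : Type*} [AddCommGroup V] [Module ℂ V] {A : VertexOperatorAlgebra V}
  {W₁ : Type*} [AddCommGroup W₁] [Module ℂ W₁] {M₁ : WeakModule A W₁}
  {W₂ : Type*} [AddCommGroup W₂] [Module ℂ W₂] {M₂ : WeakModule A W₂}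
  {W₃ : Type*} [AddCommGroup W₃] [Module ℂ W₃] {M₃ : WeakModule A W₃}
  (𝒴 : IntertwiningOperator M₁ M₂ M₃)

theorem coeff_mem_im (u : W₁) (w : W₂) (h : ℂ) (k : ℕ) : 𝒴.coeff u w h k ∈ 𝒴.im :=
  Submodule.subset_span ⟨u, w, h, k, rfl⟩

/-- The commutator formula. -/
theorem commutator (a : V) (u : W₁) (w : W₂) (m : ℤ) (h : ℂ) (k : ℕ) :
    M₃.Y a m (𝒴.coeff u w h k) = 𝒴.coeff u (M₂.Y a m w) h k
      + ∑ᶠ i : ℕ, ((Ring.choose m i : ℤ) : ℂ) • 𝒴.coeff (M₁.Y a i u) w (m + h - i) k := by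
  have hj := 𝒴.jacobi a u w 0 m h k
  have e1 := finsum_choose_zero
    (fun i => M₃.Y a (m + 0 - (i : ℤ)) (𝒴.coeff u w (h + i) k)) (fun i => (-1) ^ i)
  have e2 := finsum_choose_zero
    (fun i => 𝒴.coeff u (M₂.Y a (m + i) w) (h + (0 : ℤ) - i) k) (fun i => (-1) ^ (0 + (i : ℤ)))
  rw [e1, e2] at hj
  simp only [pow_zero, Nat.cast_zero, add_zero, zpow_zero, one_smul, sub_zero, zero_add,
    Int.cast_zero] at hj
  rw [← hj, add_sub_cancel]

/-- The iterate formula. -/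
theorem iterate (a : V) (u : W₁) (w : W₂) (l : ℤ) (h : ℂ) (k : ℕ) :
    𝒴.coeff (M₁.Y a l u) w h k =
      (∑ᶠ i : ℕ, ((-1 : ℂ) ^ i * (Ring.choose l i : ℤ)) •
        M₃.Y a (l - i) (𝒴.coeff u w (h + i) k))
      - ∑ᶠ i : ℕ, ((-1 : ℂ) ^ (l + i) * (Ring.choose l i : ℤ)) •
          𝒴.coeff u (M₂.Y a i w) (h + l - i) k := by
  have hj := 𝒴.jacobi a u w l 0 h k
  have e1 := finsum_choose_zero
    (fun i => 𝒴.coeff (M₁.Y a (l + i) u) w ((0 : ℤ) + h - i) k) (fun _ => 1)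
  simp only [one_mul] at e1
  rw [e1] at hj
  simp only [Nat.cast_zero, add_zero, one_smul, sub_zero, zero_add,
    Int.cast_zero] at hj
  exact hj.symm

theorem isInvariant_im : M₃.IsInvariant 𝒴.im := by
  intro a n x hx
  induction hx using Submodule.span_induction with
  | zero => simp
  | add x y _ _ hx hy => simpa using add_mem hx hy
  | smul c x _ hx => simpa using 𝒴.im.smul_mem c hx
  | mem x hx =>
    obtain ⟨u, w, h, k, rfl⟩ := hx
    rw [𝒴.commutator]
    exact add_mem (𝒴.coeff_mem_im _ _ _ _) (finsum_mem_submodule _ fun i =>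
      Submodule.smul_mem _ _ (𝒴.coeff_mem_im _ _ _ _))

/-- The commutator formula for `ω` at `m = 1`, with `L(-1)u` eliminated by the derivative property;
the derivative of `(log x)^(k+1)` produces the last term. -/
theorem L_zero_coeff (u : W₁) (w : W₂) (h : ℂ) (k : ℕ) :
    M₃.L 0 (𝒴.coeff u w h k) = 𝒴.coeff (M₁.L 0 u) w h k + 𝒴.coeff u (M₂.L 0 w) h k
      - (h + 1) • 𝒴.coeff u w h k + ((k : ℂ) + 1) • 𝒴.coeff u w h (k + 1) := by
  have hc := 𝒴.commutator A.conf u w 1 h k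
  rw [finsum_choose_one] at hc
  have hd := 𝒴.L_neg_one_derivative u w (h + 1) k
  simp only [Nat.cast_zero, sub_zero, Int.cast_one, Nat.cast_one, add_sub_cancel_left] at hc
  simp only [WeakModule.L, add_sub_cancel_right] at hd
  norm_num at hd
  simp only [WeakModule.L, zero_add]
  rw [hc, add_comm 1 h, hd]
  module

/-- Applying `L(0) - (a+b-h-1)` to a coefficient lowers the nilpotency order of `u` or of `w`, or
raises the power of `log x`. The proof is by induction on `r + s`, then downward on `k`. -/
theorem coeff_mem_weightSpace {a b : ℂ} {u : W₁} (hu : u ∈ M₁.weightSpace a) {w : W₂}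
    (hw : w ∈ M₂.weightSpace b) (h : ℂ) (k : ℕ) :
    𝒴.coeff u w h k ∈ M₃.weightSpace (a + b - h - 1) := by
  obtain ⟨r, hr⟩ := (Module.End.mem_maxGenEigenspace _ _ _).1 hu
  obtain ⟨s, hs⟩ := (Module.End.mem_maxGenEigenspace _ _ _).1 hw
  clear hu hw
  induction hn : r + s generalizing r s u w k with
  | zero =>
    obtain rfl : r = 0 := by omega
    have : u = 0 := by simpa using hr
    simp [this]
  | succ n ih =>
    have h1 : ∀ k, 𝒴.coeff ((M₁.L 0 - a • (1 : Module.End ℂ W₁)) u) w h k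
        ∈ M₃.weightSpace (a + b - h - 1) := by
      intro k
      rcases r with _ | r
      · have : u = 0 := by simpa using hr
        simp [this]
      · exact ih k r (by rwa [pow_succ, Module.End.mul_apply] at hr) s hs (by omega)
    have h2 : ∀ k, 𝒴.coeff u ((M₂.L 0 - b • (1 : Module.End ℂ W₂)) w) h k
        ∈ M₃.weightSpace (a + b - h - 1) := by
      intro k
      rcases s with _ | s
      · have : w = 0 := by simpa using hs
        simp [this]
      · exact ih k r hr s (by rwa [pow_succ, Module.End.mul_apply] at hs) (by omega)
    obtain ⟨K, hK⟩ : ∃ K, ∀ k, K ≤ k → 𝒴.coeff u w h k = 0 := by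
      refine ⟨(𝒴.coeff u w h).support.sup id + 1, fun k hk => ?_⟩
      by_contra hne
      have := Finset.le_sup (f := id) (Finsupp.mem_support_iff.2 hne)
      simp only [id] at this
      omega
    -- Downward induction on `k` from the bound `K` past which the coefficients vanish; `d` bounds
    -- the distance to `K`.
    have h3 : ∀ (d k : ℕ), K ≤ k + d → 𝒴.coeff u w h k ∈ M₃.weightSpace (a + b - h - 1) := by
      intro d
      induction d with
      | zero => intro k hk; rw [hK k (by omega)]; exact zero_mem _
      | succ d ihd =>
        intro k hk
        refine M₃.mem_weightSpace_of_sub ?_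
        have e : M₃.L 0 (𝒴.coeff u w h k) - (a + b - h - 1) • 𝒴.coeff u w h k
            = 𝒴.coeff ((M₁.L 0 - a • (1 : Module.End ℂ W₁)) u) w h k
              + 𝒴.coeff u ((M₂.L 0 - b • (1 : Module.End ℂ W₂)) w) h k
              + ((k : ℂ) + 1) • 𝒴.coeff u w h (k + 1) := by
          rw [𝒴.L_zero_coeff]
          simp only [LinearMap.sub_apply, LinearMap.smul_apply, Module.End.one_apply, map_sub,
            map_smul, Pi.sub_apply, Pi.smul_apply, Finsupp.sub_apply, Finsupp.smul_apply]
          module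
        rw [e]
        exact add_mem (add_mem (h1 k) (h2 k)) (Submodule.smul_mem _ _ (ihd _ (by omega)))
    exact h3 K k (by omega)

end IntertwiningOperator

/-! ### Induction on the total weight of a pair. -/

namespace WeakModule

variable {V : Type*} [AddCommGroup V] [Module ℂ V] {A : VertexOperatorAlgebra V}
  {W₁ : Type*} [AddCommGroup W₁] [Module ℂ W₁] {M₁ : WeakModule A W₁}
  {W₂ : Type*} [AddCommGroup W₂] [Module ℂ W₂] {M₂ : WeakModule A W₂}

/-- Induction on the total weight of a pair of homogeneous vectors, reducing to vectors of weights
where the weight space is not contained in `C₁`. -/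
theorem homogeneous_pair_induction (h₁ : M₁.IsC₁Module) (h₂ : M₂.IsC₁Module)
    {R : ℂ → ℂ → W₁ → W₂ → Prop}
    (zero_left : ∀ a b w, R a b 0 w) (zero_right : ∀ a b u, R a b u 0)
    (add_left : ∀ a b u u' w, R a b u w → R a b u' w → R a b (u + u') w)
    (add_right : ∀ a b u w w', R a b u w → R a b u w' → R a b u (w + w'))
    (smul_left : ∀ a b (c : ℂ) u w, R a b u w → R a b (c • u) w)
    (smul_right : ∀ a b (c : ℂ) u w, R a b u w → R a b u (c • w))
    (base : ∀ a b, ¬ M₁.weightSpace a ≤ M₁.C₁ → ¬ M₂.weightSpace b ≤ M₂.C₁ →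
      ∀ u ∈ M₁.weightSpace a, ∀ w ∈ M₂.weightSpace b, R a b u w)
    (step_left : ∀ (a b : ℂ) (n : ℤ), 1 ≤ n → ∀ v ∈ A.wt n, ∀ u ∈ M₁.weightSpace (a - n),
      ∀ w ∈ M₂.weightSpace b, R (a - n) b u w →
      (∀ i : ℕ, R (a - n) (b + n - i - 1) u (M₂.Y v i w)) → R a b (M₁.Y v (-1) u) w)
    (step_right : ∀ (a b : ℂ) (n : ℤ), 1 ≤ n → ∀ v ∈ A.wt n, ∀ u ∈ M₁.weightSpace a,
      ∀ w ∈ M₂.weightSpace (b - n), R a (b - n) u w →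
      (∀ i : ℕ, R (a + n - i - 1) (b - n) (M₁.Y v i u) w) → R a b u (M₂.Y v (-1) w))
    (a b : ℂ) (u : W₁) (hu : u ∈ M₁.weightSpace a) (w : W₂) (hw : w ∈ M₂.weightSpace b) :
    R a b u w := by
  obtain ⟨N₁, hN₁⟩ := h₁.isGradingRestricted.2 a
  obtain ⟨N₂, hN₂⟩ := h₂.isGradingRestricted.2 b
  have key : ∀ (s : ℕ) (p q : ℤ), p + q < N₁ + N₂ + s → ∀ u ∈ M₁.weightSpace (a + p),
      ∀ w ∈ M₂.weightSpace (b + q), R (a + p) (b + q) u w := by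
    intro s
    induction s with
    | zero =>
      intro p q hpq u hu w hw
      -- As `p + q < N₁ + N₂`, one of the two weight spaces is zero.
      by_cases hp : p ≤ N₁
      · rw [hN₁ p hp, Submodule.mem_bot] at hu
        rw [hu]
        exact zero_left _ _ _
      · rw [hN₂ q (by push_cast at hpq; omega), Submodule.mem_bot] at hw
        rw [hw]
        exact zero_right _ _ _
    | succ s ih =>
      intro p q hpq u hu w hw
      push_cast at hpq
      by_cases hp : M₁.weightSpace (a + p) ≤ M₁.C₁
      · have hu' := mem_homogeneousC₁ h₁.isGeneralized hu (hp hu)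
        clear hu
        induction hu' using Submodule.span_induction with
        | zero => exact zero_left _ _ _
        | add x y _ _ hx hy => exact add_left _ _ _ _ _ hx hy
        | smul c x _ hx => exact smul_left _ _ _ _ _ hx
        | mem x hx =>
          obtain ⟨n, hn, v, hv, u, hu, rfl⟩ := hx
          have e : a + p - n = a + ((p - n : ℤ) : ℂ) := by push_cast; ring
          refine step_left _ _ n hn v hv u hu w hw ?_ fun i => ?_
          · rw [e] at hu ⊢
            exact ih _ _ (by omega) u hu w hw
          -- The new pair has weights `p - n` and `q + n - i - 1`, so the total drops by `i + 1`.
          · have e' : b + q + n - i - 1 = b + ((q + n - i - 1 : ℤ) : ℂ) := by push_cast; ring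
            have hw' := M₂.mode_mem_weightSpace hv i hw
            rw [Int.cast_natCast, e'] at hw'
            rw [e] at hu ⊢
            rw [e']
            exact ih _ _ (by omega) u hu _ hw'
      · by_cases hq : M₂.weightSpace (b + q) ≤ M₂.C₁
        · have hw' := mem_homogeneousC₁ h₂.isGeneralized hw (hq hw)
          clear hw
          induction hw' using Submodule.span_induction with
          | zero => exact zero_right _ _ _
          | add x y _ _ hx hy => exact add_right _ _ _ _ _ hx hy
          | smul c x _ hx => exact smul_right _ _ _ _ _ hx
          | mem x hx =>
            obtain ⟨n, hn, v, hv, w, hw, rfl⟩ := hx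
            have e : b + q - n = b + ((q - n : ℤ) : ℂ) := by push_cast; ring
            refine step_right _ _ n hn v hv u hu w hw ?_ fun i => ?_
            · rw [e] at hw ⊢
              exact ih _ _ (by omega) u hu w hw
            · have e' : a + p + n - i - 1 = a + ((p + n - i - 1 : ℤ) : ℂ) := by push_cast; ring
              have hu' := M₁.mode_mem_weightSpace hv i hu
              rw [Int.cast_natCast, e'] at hu'
              rw [e] at hw ⊢
              rw [e']
              exact ih _ _ (by omega) _ hu' w hw
        · exact base _ _ hp hq u hu w hw
  have := key (1 - N₁ - N₂).toNat 0 0 (by omega)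
  simp only [Int.cast_zero, add_zero] at this
  exact this u hu w hw

end WeakModule

/-! ### Finite-dimensional spaces of logarithmic series. -/

open Filter in
theorem eventually_forall_mem_of_fg {R E F : Type*} [Semiring R] [AddCommMonoid E] [Module R E]
    [AddCommMonoid F] [Module R F] {P : Submodule R E} (hP : P.FG) (f : ℕ → E →ₗ[R] F)
    (h : ∀ x ∈ P, ∀ᶠ n in atTop, f n x = 0) : ∀ᶠ n in atTop, ∀ x ∈ P, f n x = 0 := by
  obtain ⟨S, rfl⟩ := hP
  have hS : ∀ᶠ n in atTop, ∀ x ∈ S, f n x = 0 :=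
    (eventually_all_finset S).2 fun x hx => h x (Submodule.subset_span hx)
  filter_upwards [hS] with n hn x hx
  have : Submodule.span R (S : Set E) ≤ LinearMap.ker (f n) :=
    Submodule.span_le.2 fun y hy => hn y hy
  exact this hx

/-- The operator `x d/dx`, on the coefficient functions of `∑ f(c, k) x^c (log x)^k`. -/
def eulerOperator (Q : Type*) [AddCommGroup Q] [Module ℂ Q] : Module.End ℂ (ℂ → ℕ → Q) where
  toFun f := fun c k => c • f c k + ((k : ℂ) + 1) • f c (k + 1)
  map_add' f g := by
    ext c k
    simp only [Pi.add_apply]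
    module
  map_smul' r f := by
    ext c k
    simp only [Pi.smul_apply, RingHom.id_apply]
    module

theorem eulerOperator_apply {Q : Type*} [AddCommGroup Q] [Module ℂ Q] (f : ℂ → ℕ → Q) (c : ℂ)
    (k : ℕ) : eulerOperator Q f c k = c • f c k + ((k : ℂ) + 1) • f c (k + 1) := rfl

open Filter in
/-- A finite-dimensional space of logarithmic series stable under `x d/dx` has a finite-dimensional
space of coefficients. -/
theorem fg_span_coeff {Q : Type*} [AddCommGroup Q] [Module ℂ Q] {P : Submodule ℂ (ℂ → ℕ → Q)}
    (hP : P.FG) (hB : ∀ f ∈ P, eulerOperator Q f ∈ P)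
    (hlog : ∀ f ∈ P, ∀ c, ∀ᶠ k in atTop, f c k = 0) :
    (Submodule.span ℂ {x | ∃ f ∈ P, ∃ c k, x = f c k}).FG := by
  have : FiniteDimensional ℂ P := (Submodule.fg_iff_finiteDimensional _).1 hP
  let g : Module.End ℂ P := (eulerOperator Q).restrict hB
  let ev (c : ℂ) (k : ℕ) : (ℂ → ℕ → Q) →ₗ[ℂ] Q := LinearMap.proj k ∘ₗ LinearMap.proj c
  -- At exponent `c`, the operator `x d/dx - c` acts as the derivative in `log x`. Its `k`-th power
  -- thus brings the coefficient of `(log x)^(j+k)` down to `(log x)^j` with factor `(j+k)!/j!`.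
  have hpow : ∀ (c : ℂ) (k : ℕ) (j : ℕ) (f : P),
      (((g - c • (1 : Module.End ℂ P)) ^ k) f : ℂ → ℕ → Q) c j
        = ((j + k).descFactorial k : ℂ) • (f : ℂ → ℕ → Q) c (j + k) := by
    intro c k
    induction k with
    | zero => simp
    | succ k ih =>
      intro j f
      have e : ((g - c • (1 : Module.End ℂ P)) f : ℂ → ℕ → Q) c (j + k)
          = ((j + k : ℕ) + 1 : ℂ) • (f : ℂ → ℕ → Q) c (j + k + 1) := by
        show eulerOperator Q (f : ℂ → ℕ → Q) c (j + k) - c • (f : ℂ → ℕ → Q) c (j + k) = _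
        rw [eulerOperator_apply]
        module
      rw [pow_succ, Module.End.mul_apply, ih, e, ← add_assoc, Nat.succ_descFactorial_succ,
        smul_smul]
      push_cast
      ring_nf
  have hfin : {c | g.HasEigenvalue c}.Finite := Module.End.finite_hasEigenvalue g
  -- If `c` is not an eigenvalue, `g - c` is bijective on `P`, so `f = (g - c)^K f'`. With `K`
  -- beyond all powers of `log x` at exponent `c` in `P`, the coefficient of `f` is `K! f'(c, K) =
  -- 0`.
  have hzero : ∀ c, ¬ g.HasEigenvalue c → ∀ f ∈ P, f c 0 = 0 := by
    intro c hc f hf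
    obtain ⟨K, hK⟩ := (eventually_forall_mem_of_fg hP (ev c) fun f hf => hlog f hf c).exists
    have hinj : Function.Injective (g - c • (1 : Module.End ℂ P)) := by
      rw [← LinearMap.ker_eq_bot]
      by_contra hne
      exact hc (by
        rw [Module.End.hasEigenvalue_iff, Module.End.eigenspace_def]
        exact hne)
    have hinj' : Function.Injective ((g - c • (1 : Module.End ℂ P)) ^ K) := by
      rw [Module.End.coe_pow]
      exact hinj.iterate K
    obtain ⟨f', hf'⟩ := LinearMap.injective_iff_surjective.1 hinj' ⟨f, hf⟩
    have h := hpow c K 0 f'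
    have h' : (f' : ℂ → ℕ → Q) c K = 0 := hK f' f'.2
    rw [hf', zero_add, h', smul_zero] at h
    exact h
  have hle : Submodule.span ℂ {x | ∃ f ∈ P, ∃ c k, x = f c k} ≤
      ⨆ c ∈ hfin.toFinset, P.map (ev c 0) := by
    refine Submodule.span_le.2 ?_
    rintro x ⟨f, hf, c, k, rfl⟩
    have h := hpow c k 0 ⟨f, hf⟩
    set f' := ((g - c • (1 : Module.End ℂ P)) ^ k) ⟨f, hf⟩
    have hne : ((0 + k).descFactorial k : ℂ) ≠ 0 := by
      rw [zero_add, Nat.descFactorial_self]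
      exact_mod_cast k.factorial_ne_zero
    rw [zero_add] at hne h
    -- Every coefficient is a log-free coefficient of another element of `P`, so evaluation at `(c,
    -- 0)` for the eigenvalues `c` suffices.
    have hx : f c k = ((k.descFactorial k : ℂ))⁻¹ • (f' : ℂ → ℕ → Q) c 0 := by
      rw [h, smul_smul, inv_mul_cancel₀ hne, one_smul]
    show f c k ∈ _
    rw [hx]
    refine Submodule.smul_mem _ _ ?_
    by_cases hc : g.HasEigenvalue c
    · exact Submodule.mem_iSup_of_mem c (Submodule.mem_iSup_of_mem (hfin.mem_toFinset.2 hc)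
        ⟨f', f'.2, rfl⟩)
    · rw [hzero c hc _ f'.2]
      exact zero_mem _
  have hfg : (⨆ c ∈ hfin.toFinset, P.map (ev c 0)).FG :=
    Submodule.fg_biSup _ _ fun c _ => hP.map _
  have : FiniteDimensional ℂ _ := (Submodule.fg_iff_finiteDimensional _).1 hfg
  exact (Submodule.fg_iff_finiteDimensional _).2 (Submodule.finiteDimensional_of_le hle)

/-! ### The image: lower bound on weights and cofiniteness. -/

namespace IntertwiningOperator

open Filter

variable {V : Type*} [AddCommGroup V] [Module ℂ V] {A : VertexOperatorAlgebra V}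
  {W₁ : Type*} [AddCommGroup W₁] [Module ℂ W₁] {M₁ : WeakModule A W₁}
  {W₂ : Type*} [AddCommGroup W₂] [Module ℂ W₂] {M₂ : WeakModule A W₂}
  {W₃ : Type*} [AddCommGroup W₃] [Module ℂ W₃] {M₃ : WeakModule A W₃}
  (𝒴 : IntertwiningOperator M₁ M₂ M₃)

theorem im_le_of_homogeneous (h₁ : M₁.IsGeneralized) (h₂ : M₂.IsGeneralized)
    {S : Submodule ℂ W₃} (hS : ∀ a b, ∀ u ∈ M₁.weightSpace a, ∀ w ∈ M₂.weightSpace b, ∀ h k,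
      𝒴.coeff u w h k ∈ S) : 𝒴.im ≤ S := by
  refine Submodule.span_le.2 ?_
  rintro x ⟨u, w, h, k, rfl⟩
  have hu : u ∈ ⨆ h, M₁.weightSpace h := by rw [M₁.isGeneralized_iff.1 h₁]; trivial
  have hw : w ∈ ⨆ h, M₂.weightSpace h := by rw [M₂.isGeneralized_iff.1 h₂]; trivial
  show 𝒴.coeff u w h k ∈ S
  induction hu using Submodule.iSup_induction' with
  | zero => simp
  | add u u' _ _ h h' => simpa using add_mem h h'
  | mem a u hu =>
    induction hw using Submodule.iSup_induction' with
    | zero => simp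
    | add u u' _ _ h h' => simpa using add_mem h h'
    | mem b w hw => exact hS a b u hu w hw h k

theorem eventually_coeff_eq_zero {P : Submodule ℂ W₁} (hP : P.FG) {Q : Submodule ℂ W₂} (hQ : Q.FG)
    (h : ℂ) : ∀ᶠ n : ℕ in atTop, ∀ u ∈ P, ∀ w ∈ Q, 𝒴.coeff u w (h + n) = 0 := by
  have hu : ∀ u ∈ P, ∀ᶠ n : ℕ in atTop, ∀ w ∈ Q, 𝒴.coeff u w (h + n) = 0 := fun u _ =>
    eventually_forall_mem_of_fg hQ
      (fun n : ℕ => (LinearMap.proj (h + n) : (ℂ → (ℕ →₀ W₃)) →ₗ[ℂ] _) ∘ₗ 𝒴.coeff u) fun w _ => by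
        obtain ⟨N, hN⟩ := 𝒴.lower_truncation h u w
        exact eventually_atTop.2 ⟨N, fun n hn => Finsupp.ext fun k => hN n hn k⟩
  have := eventually_forall_mem_of_fg hP (fun n : ℕ =>
    ((LinearMap.proj (h + n) : (ℂ → (ℕ →₀ W₃)) →ₗ[ℂ] _).compRight ℂ ∘ₗ
      (LinearMap.lcomp ℂ (ℂ → (ℕ →₀ W₃)) Q.subtype) ∘ₗ 𝒴.coeff)) fun u hu' => by
        filter_upwards [hu u hu'] with n hn
        ext w : 1
        exact hn w w.2
  filter_upwards [this] with n hn u hu w hw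
  exact LinearMap.congr_fun (hn u hu) ⟨w, hw⟩

theorem im_lower_bounded (h₁ : M₁.IsC₁Module) (h₂ : M₂.IsC₁Module) (h₀ : ℂ) :
    ∃ N : ℤ, ∀ n : ℤ, n ≤ N → Disjoint (M₃.weightSpace (h₀ + n)) 𝒴.im := by
  -- The index `a + b - 1 - h₀ + n` is the one whose coefficient has weight `h₀ - n`.
  have hbase : ∀ᶠ n : ℕ in atTop, ∀ a ∈ {a | ¬ M₁.weightSpace a ≤ M₁.C₁},
      ∀ b ∈ {b | ¬ M₂.weightSpace b ≤ M₂.C₁}, ∀ u ∈ M₁.weightSpace a, ∀ w ∈ M₂.weightSpace b,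
      𝒴.coeff u w (a + b - 1 - h₀ + n) = 0 := by
    refine (eventually_all_finite
      (WeakModule.finite_weightSpace_not_le_C₁ h₁.isC₁Cofinite)).2 fun a _ => ?_
    refine (eventually_all_finite
      (WeakModule.finite_weightSpace_not_le_C₁ h₂.isC₁Cofinite)).2 fun b _ => ?_
    exact 𝒴.eventually_coeff_eq_zero
      ((Submodule.fg_iff_finiteDimensional _).2 (h₁.isGradingRestricted.1 a))
      ((Submodule.fg_iff_finiteDimensional _).2 (h₂.isGradingRestricted.1 b)) _
  obtain ⟨N, hN⟩ := eventually_atTop.1 hbase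
  -- `Z` omits exactly the weights `h₀ - n` with `n ≥ N`. This set of omitted weights is closed
  -- under subtracting natural numbers, so weight-raising modes preserve `Z`.
  let Z : Submodule ℂ W₃ :=
    ⨆ c : {c : ℂ // ∀ n : ℕ, N ≤ n → c ≠ h₀ - n}, M₃.weightSpace c
  have hZ : ∀ n : ℤ, 1 ≤ n → ∀ v ∈ A.wt n, ∀ i : ℕ, ∀ x ∈ Z, M₃.Y v (-1 - i) x ∈ Z := by
    intro n hn v hv i x hx
    induction hx using Submodule.iSup_induction' with
    | zero => simp
    | add x y _ _ hx hy => simpa using add_mem hx hy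
    | mem c x hx =>
      refine Submodule.mem_iSup_of_mem ⟨_, fun m hm hc => ?_⟩ (M₃.mode_mem_weightSpace hv _ hx)
      refine c.2 (m + n.toNat + i) (by omega) ?_
      have hn' : ((n.toNat : ℕ) : ℂ) = n := by
        have : ((n.toNat : ℕ) : ℤ) = n := Int.toNat_of_nonneg (by omega)
        exact_mod_cast congrArg (Int.cast : ℤ → ℂ) this
      push_cast at hc ⊢
      rw [hn']
      linear_combination hc
  have him : 𝒴.im ≤ Z := by
    refine 𝒴.im_le_of_homogeneous h₁.isGeneralized h₂.isGeneralized fun a b u hu w hw => ?_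
    refine WeakModule.homogeneous_pair_induction h₁ h₂
      (R := fun _ _ u w => ∀ h k, 𝒴.coeff u w h k ∈ Z) ?_ ?_ ?_ ?_ ?_ ?_ ?_ ?_ ?_ a b u hu w hw
    · intros; simp
    · intros; simp
    · intro a b u u' w hu hu' h k
      simpa using add_mem (hu h k) (hu' h k)
    · intro a b u w w' hu hu' h k
      simpa using add_mem (hu h k) (hu' h k)
    · intro a b c u w hu h k
      simpa using Z.smul_mem c (hu h k)
    · intro a b c u w hu h k
      simpa using Z.smul_mem c (hu h k)
    · intro a b ha hb u hu w hw h k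
      by_cases hc : ∃ n : ℕ, N ≤ n ∧ a + b - h - 1 = h₀ - n
      · obtain ⟨n, hn, hc⟩ := hc
        have := hN n hn a ha b hb u hu w hw
        rw [show a + b - 1 - h₀ + n = h by linear_combination hc] at this
        rw [this]
        exact zero_mem _
      · push Not at hc
        exact Submodule.mem_iSup_of_mem ⟨_, hc⟩ (𝒴.coeff_mem_weightSpace hu hw h k)
    · intro a b n hn v hv u _ w _ h0 hi h k
      rw [𝒴.iterate]
      exact sub_mem
        (finsum_mem_submodule _ fun i => Z.smul_mem _ (hZ n hn v hv i _ (h0 _ _)))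
        (finsum_mem_submodule _ fun i => Z.smul_mem _ (hi i _ _))
    · intro a b n hn v hv u _ w _ h0 hi h k
      have := 𝒴.commutator v u w (-1) h k
      rw [← sub_eq_iff_eq_add] at this
      rw [← this]
      refine sub_mem ?_ (finsum_mem_submodule _ fun i => Z.smul_mem _ (hi i _ _))
      simpa using hZ n hn v hv 0 _ (h0 h k)
  refine ⟨-N, fun n hn => ?_⟩
  refine (M₃.iSupIndep_weightSpace (h₀ + n)).mono_right (him.trans (iSup_le fun c => ?_))
  refine le_iSup₂ (f := fun j (_ : j ≠ h₀ + n) => M₃.weightSpace j) (c : ℂ) fun hc => ?_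
  refine c.2 (-n).toNat (by omega) ?_
  have hn' : (((-n).toNat : ℕ) : ℂ) = -n := by
    have : (((-n).toNat : ℕ) : ℤ) = -n := Int.toNat_of_nonneg (by omega)
    exact_mod_cast congrArg (Int.cast : ℤ → ℂ) this
  rw [hn', hc]
  ring

/-- The coefficients of `𝒴(u, x)w` modulo a subspace, for `u` of weight `a` and `w` of weight `b`,
reindexed by their own weight. -/
noncomputable def weightedCoeff (C : Submodule ℂ W₃) (a b : ℂ) : W₁ →ₗ[ℂ] W₂ →ₗ[ℂ] (ℂ → ℕ → W₃ ⧸ C) :=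
  LinearMap.mk₂ ℂ (fun u w c k => C.mkQ (𝒴.coeff u w (a + b - c - 1) k))
    (fun u u' w => by ext c k; simp) (fun r u w => by ext c k; simp)
    (fun u w w' => by ext c k; simp) (fun r u w => by ext c k; simp)

theorem weightedCoeff_apply (C : Submodule ℂ W₃) (a b : ℂ) (u : W₁) (w : W₂) (c : ℂ) (k : ℕ) :
    𝒴.weightedCoeff C a b u w c k = C.mkQ (𝒴.coeff u w (a + b - c - 1) k) := rfl

/-- The product rule for `x^(a+b) 𝒴(u, x)w`. Since `L(-1)` raises the weight by one, the extra
factor `x` is absorbed in the normalization of the new series. -/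
theorem eulerOperator_weightedCoeff (C : Submodule ℂ W₃) (a b : ℂ) (u : W₁) (w : W₂) :
    eulerOperator _ (𝒴.weightedCoeff C a b u w)
      = 𝒴.weightedCoeff C (a + 1) b (M₁.L (-1) u) w
        + (a + b) • 𝒴.weightedCoeff C a b u w := by
  ext c k
  simp only [eulerOperator_apply, Pi.add_apply, Pi.smul_apply, weightedCoeff_apply,
    𝒴.L_neg_one_derivative, map_add, map_smul]
  rw [show a + 1 + b - c - 1 - 1 = a + b - c - 1 by ring]
  module

/-- Modulo `C` the modes `v_{-1-i}` drop out of the iterate and commutator formulas, leaving scalar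
combinations of normalized series of lower total weight. -/
theorem weightedCoeff_mem (h₁ : M₁.IsC₁Module) (h₂ : M₂.IsC₁Module) {C : Submodule ℂ W₃}
    (hC : ∀ n : ℤ, 1 ≤ n → ∀ v ∈ A.wt n, ∀ i : ℕ, ∀ x ∈ 𝒴.im, M₃.Y v (-1 - i) x ∈ C)
    {P : Submodule ℂ (ℂ → ℕ → W₃ ⧸ C)}
    (hP : ∀ a b, ¬ M₁.weightSpace a ≤ M₁.C₁ → ¬ M₂.weightSpace b ≤ M₂.C₁ →
      ∀ u ∈ M₁.weightSpace a, ∀ w ∈ M₂.weightSpace b, 𝒴.weightedCoeff C a b u w ∈ P)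
    {a b : ℂ} {u : W₁} (hu : u ∈ M₁.weightSpace a) {w : W₂} (hw : w ∈ M₂.weightSpace b) :
    𝒴.weightedCoeff C a b u w ∈ P := by
  refine WeakModule.homogeneous_pair_induction h₁ h₂
    (R := fun a b u w => 𝒴.weightedCoeff C a b u w ∈ P) ?_ ?_ ?_ ?_ ?_ ?_ hP ?_ ?_ a b u hu w hw
  · intros; simp
  · intros; simp
  · intro a b u u' w hu hu'
    simpa using add_mem hu hu'
  · intro a b u w w' hu hu'
    simpa using add_mem hu hu'
  · intro a b c u w hu
    simpa using P.smul_mem c hu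
  · intro a b c u w hu
    simpa using P.smul_mem c hu
  · intro a b n hn v hv u _ w _ _ hi
    obtain ⟨N, hN⟩ := M₂.lower_truncation v w
    -- `N` depends on `v` and `w` but not on `(c, k)`, so this is a finite linear relation between
    -- whole series.
    have e : 𝒴.weightedCoeff C a b (M₁.Y v (-1) u) w = -∑ i ∈ Finset.range N,
        ((-1 : ℂ) ^ ((-1 : ℤ) + i) * (Ring.choose (-1 : ℤ) i : ℤ)) •
          𝒴.weightedCoeff C (a - n) (b + n - i - 1) u (M₂.Y v i w) := by
      ext c k
      simp only [weightedCoeff_apply, 𝒴.iterate, map_sub, Pi.neg_apply, Finset.sum_apply,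
        Pi.smul_apply]
      have h0 : (∑ᶠ i : ℕ, ((-1 : ℂ) ^ i * (Ring.choose (-1 : ℤ) i : ℤ)) •
          M₃.Y v (-1 - i) (𝒴.coeff u w (a + b - c - 1 + i) k)) ∈ C :=
        finsum_mem_submodule _ fun i =>
          C.smul_mem _ (hC n hn v hv i _ (𝒴.coeff_mem_im _ _ _ _))
      rw [Submodule.mkQ_apply, (Submodule.Quotient.mk_eq_zero C).2 h0, zero_sub,
        finsum_eq_sum_of_support_subset (s := Finset.range N), map_sum]
      · congr 1
        refine Finset.sum_congr rfl fun i _ => ?_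
        rw [map_smul, show a + b - c - 1 + ((-1 : ℤ) : ℂ) - i = a - n + (b + n - i - 1) - c - 1 by
          push_cast; ring]
      · intro i hi
        by_contra hc
        refine hi ?_
        simp only [Finset.coe_range, Set.mem_Iio, not_lt] at hc
        simp [hN i hc]
    rw [e]
    exact neg_mem (sum_mem fun i _ => P.smul_mem _ (hi i))
  · intro a b n hn v hv u _ w _ _ hi
    obtain ⟨N, hN⟩ := M₁.lower_truncation v u
    have e : 𝒴.weightedCoeff C a b u (M₂.Y v (-1) w) = -∑ i ∈ Finset.range N,
        ((Ring.choose (-1 : ℤ) i : ℤ) : ℂ) •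
          𝒴.weightedCoeff C (a + n - i - 1) (b - n) (M₁.Y v i u) w := by
      ext c k
      have hcomm := 𝒴.commutator v u w (-1) (a + b - c - 1) k
      rw [← sub_eq_iff_eq_add] at hcomm
      simp only [weightedCoeff_apply, ← hcomm, map_sub, Pi.neg_apply, Finset.sum_apply,
        Pi.smul_apply]
      have h0 := hC n hn v hv 0 _ (𝒴.coeff_mem_im u w (a + b - c - 1) k)
      rw [Nat.cast_zero, sub_zero] at h0
      rw [Submodule.mkQ_apply, (Submodule.Quotient.mk_eq_zero C).2 h0, zero_sub,
        finsum_eq_sum_of_support_subset (s := Finset.range N), map_sum]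
      · congr 1
        refine Finset.sum_congr rfl fun i _ => ?_
        rw [map_smul, show ((-1 : ℤ) : ℂ) + (a + b - c - 1) - i
          = a + n - i - 1 + (b - n) - c - 1 by push_cast; ring]
      · intro i hi
        by_contra hc
        refine hi ?_
        simp only [Finset.coe_range, Set.mem_Iio, not_lt] at hc
        simp [hN i hc]
    rw [e]
    exact neg_mem (sum_mem fun i _ => P.smul_mem _ (hi i))

theorem fg_map_mkQ_im (h₁ : M₁.IsC₁Module) (h₂ : M₂.IsC₁Module) {C : Submodule ℂ W₃}
    (hC : ∀ n : ℤ, 1 ≤ n → ∀ v ∈ A.wt n, ∀ i : ℕ, ∀ x ∈ 𝒴.im, M₃.Y v (-1 - i) x ∈ C) :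
    (𝒴.im.map C.mkQ).FG := by
  have hf₁ := WeakModule.finite_weightSpace_not_le_C₁ h₁.isC₁Cofinite
  have hf₂ := WeakModule.finite_weightSpace_not_le_C₁ h₂.isC₁Cofinite
  let P : Submodule ℂ (ℂ → ℕ → W₃ ⧸ C) := ⨆ a ∈ hf₁.toFinset, ⨆ b ∈ hf₂.toFinset,
    Submodule.map₂ (𝒴.weightedCoeff C a b) (M₁.weightSpace a) (M₂.weightSpace b)
  have hPfg : P.FG := Submodule.fg_biSup _ _ fun a _ => Submodule.fg_biSup _ _ fun b _ =>
    Submodule.FG.map₂ _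
      ((Submodule.fg_iff_finiteDimensional _).2 (h₁.isGradingRestricted.1 a))
      ((Submodule.fg_iff_finiteDimensional _).2 (h₂.isGradingRestricted.1 b))
  have hmem : ∀ {a b : ℂ} {u : W₁}, u ∈ M₁.weightSpace a → ∀ {w : W₂}, w ∈ M₂.weightSpace b →
      𝒴.weightedCoeff C a b u w ∈ P := by
    refine fun {a b u} hu {w} hw => 𝒴.weightedCoeff_mem h₁ h₂ hC (fun a b ha hb u hu w hw => ?_) hu hw
    exact Submodule.mem_iSup_of_mem a (Submodule.mem_iSup_of_mem (hf₁.mem_toFinset.2 ha)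
      (Submodule.mem_iSup_of_mem b (Submodule.mem_iSup_of_mem (hf₂.mem_toFinset.2 hb)
        (Submodule.apply_mem_map₂ _ hu hw))))
  have hind : ∀ S : Submodule ℂ (ℂ → ℕ → W₃ ⧸ C), (∀ a b, ∀ u ∈ M₁.weightSpace a,
      ∀ w ∈ M₂.weightSpace b, 𝒴.weightedCoeff C a b u w ∈ S) → P ≤ S := fun S hS =>
    iSup₂_le fun a _ => iSup₂_le fun b _ => Submodule.map₂_le.2 (hS a b)
  have hB : ∀ f ∈ P, eulerOperator _ f ∈ P := by
    refine hind (P.comap (eulerOperator _)) fun a b u hu w hw => ?_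
    rw [Submodule.mem_comap, 𝒴.eulerOperator_weightedCoeff]
    refine add_mem (hmem ?_ hw) (P.smul_mem _ (hmem hu hw))
    have := M₁.mode_mem_weightSpace A.conf_mem 0 hu
    rw [show a + (2 : ℤ) - (0 : ℤ) - 1 = a + 1 by push_cast; ring] at this
    exact this
  have hlog : ∀ f ∈ P, ∀ c, ∀ᶠ k in atTop, f c k = 0 := by
    intro f hf c
    refine hind
      { carrier := {f | ∀ᶠ k in atTop, f c k = 0}
        add_mem' := fun {f g} hf hg => by
          filter_upwards [hf, hg] with k h h'
          simp [h, h']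
        zero_mem' := Eventually.of_forall fun _ => rfl
        smul_mem' := fun r f hf => by
          filter_upwards [hf] with k h
          simp [h] } (fun a b u _ w _ => ?_) hf
    refine eventually_atTop.2 ⟨(𝒴.coeff u w (a + b - c - 1)).support.sup id + 1, fun k hk => ?_⟩
    rw [weightedCoeff_apply]
    by_contra hne
    have hne' : 𝒴.coeff u w (a + b - c - 1) k ≠ 0 := fun h => hne (by rw [h, map_zero])
    have := Finset.le_sup (f := id) (Finsupp.mem_support_iff.2 hne')
    simp only [id] at this
    omega
  have : FiniteDimensional ℂ _ :=
    (Submodule.fg_iff_finiteDimensional _).1 (fg_span_coeff hPfg hB hlog)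
  have hle : 𝒴.im.map C.mkQ ≤ Submodule.span ℂ {x | ∃ f ∈ P, ∃ c k, x = f c k} := by
    refine Submodule.map_le_iff_le_comap.2 (𝒴.im_le_of_homogeneous h₁.isGeneralized
      h₂.isGeneralized fun a b u hu w hw h k => Submodule.subset_span
        ⟨𝒴.weightedCoeff C a b u w, hmem hu hw, a + b - h - 1, k, ?_⟩)
    rw [weightedCoeff_apply, show a + b - (a + b - h - 1) - 1 = h by ring]
  exact (Submodule.fg_iff_finiteDimensional _).2 (Submodule.finiteDimensional_of_le hle)

end IntertwiningOperator

/-! ### Restriction to an invariant subspace. -/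

namespace WeakModule

variable {V : Type*} [AddCommGroup V] [Module ℂ V] {A : VertexOperatorAlgebra V}
  {W : Type*} [AddCommGroup W] [Module ℂ W] (M : WeakModule A W)

theorem weightSpace_restrict (S : Submodule ℂ W) (hS : M.IsInvariant S) (h : ℂ) :
    (M.restrict S hS).weightSpace h = (M.weightSpace h).comap S.subtype :=
  Module.End.genEigenspace_restrict (M.L 0) S ⊤ h (hS A.conf (0 + 1))

theorem isGeneralized_restrict (S : Submodule ℂ W) (hS : M.IsInvariant S)
    (h : S ≤ ⨆ c, M.weightSpace c ⊓ S) : (M.restrict S hS).IsGeneralized := by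
  rw [isGeneralized_iff, eq_top_iff]
  rintro ⟨x, hx⟩ -
  have hx' := h hx
  have : (⨆ c, M.weightSpace c ⊓ S) = (⨆ c, (M.restrict S hS).weightSpace c).map S.subtype := by
    rw [Submodule.map_iSup]
    refine iSup_congr fun c => ?_
    rw [weightSpace_restrict, Submodule.map_comap_subtype, inf_comm]
  rw [this] at hx'
  obtain ⟨y, hy, rfl⟩ := hx'
  exact hy

end WeakModule

end VOA

theorem corollary2p9 {V : Type*} [AddCommGroup V] [Module ℂ V] (A : VOA.VertexOperatorAlgebra V)
    {W₁ : Type*} [AddCommGroup W₁] [Module ℂ W₁] (M₁ : VOA.WeakModule A W₁)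
    {W₂ : Type*} [AddCommGroup W₂] [Module ℂ W₂] (M₂ : VOA.WeakModule A W₂)
    {X : Type*} [AddCommGroup X] [Module ℂ X] (MX : VOA.WeakModule A X)
    (h₁ : M₁.IsC₁Module) (h₂ : M₂.IsC₁Module) (hX : MX.IsGeneralized)
    (𝒴 : VOA.IntertwiningOperator M₁ M₂ MX) :
    ∃ hinv : MX.IsInvariant 𝒴.im, (MX.restrict 𝒴.im hinv).IsC₁Module := by
  have hinv := 𝒴.isInvariant_im
  have hgen : (MX.restrict 𝒴.im hinv).IsGeneralized :=
    MX.isGeneralized_restrict _ hinv <|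
      𝒴.im_le_of_homogeneous h₁.isGeneralized h₂.isGeneralized fun a b u hu w hw h k =>
        Submodule.mem_iSup_of_mem (a + b - h - 1)
          ⟨𝒴.coeff_mem_weightSpace hu hw h k, 𝒴.coeff_mem_im u w h k⟩
  have hlow : ∀ h : ℂ, ∃ N : ℤ, ∀ n : ℤ, n ≤ N →
      (MX.restrict 𝒴.im hinv).weightSpace (h + n) = ⊥ := by
    intro h
    obtain ⟨N, hN⟩ := 𝒴.im_lower_bounded h₁ h₂ h
    refine ⟨N, fun n hn => ?_⟩
    rw [MX.weightSpace_restrict, Submodule.eq_bot_iff]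
    exact fun x hx => Subtype.ext (Submodule.disjoint_def.1 (hN n hn) x hx x.2)
  have hcof : (MX.restrict 𝒴.im hinv).IsC₁Cofinite := by
    let D := (MX.restrict 𝒴.im hinv).C₁
    have hfg := 𝒴.fg_map_mkQ_im h₁ h₂ (C := D.map 𝒴.im.subtype) fun n hn v hv i x hx =>
      ⟨_, (MX.restrict 𝒴.im hinv).mode_neg_mem_C₁ hn hv i ⟨x, hx⟩, rfl⟩
    -- The coefficients were treated in a quotient of `X`. Cofiniteness is transferred to `im 𝒴 /
    -- C₁(im 𝒴)` by this injection, whose range is the finite-dimensional space in `hfg`.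
    let f : (𝒴.im ⧸ D) →ₗ[ℂ] (X ⧸ D.map 𝒴.im.subtype) :=
      D.mapQ _ 𝒴.im.subtype (Submodule.le_comap_map _ _)
    have hf : LinearMap.ker f = ⊥ := by
      rw [Submodule.eq_bot_iff]
      intro x hx
      obtain ⟨x, rfl⟩ := D.mkQ_surjective x
      obtain ⟨y, hy, hyx⟩ := (Submodule.Quotient.mk_eq_zero _).1 hx
      rw [Submodule.mkQ_apply, Submodule.Quotient.mk_eq_zero]
      rwa [← Subtype.ext hyx]
    refine ⟨Submodule.fg_of_fg_map_of_fg_inf_ker f ?_ (by simp [hf, Submodule.fg_bot])⟩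
    have hmap : Submodule.map f ⊤ = 𝒴.im.map (D.map 𝒴.im.subtype).mkQ := by
      ext x
      constructor
      · rintro ⟨y, -, rfl⟩
        obtain ⟨y, rfl⟩ := D.mkQ_surjective y
        exact ⟨y, y.2, rfl⟩
      · rintro ⟨y, hy, rfl⟩
        exact ⟨D.mkQ ⟨y, hy⟩, trivial, rfl⟩
    rwa [hmap]
  exact ⟨hinv, hgen, ⟨VOA.WeakModule.weightSpace_finiteDimensional hgen hcof hlow, hlow⟩, hcof⟩
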